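/- Let $I\subseteq\mathbb R$ be a nonempty open interval, $d\in\mathbb N$, and let $\mu$ be a probability measure on a measurable space $(T,\mathcal A)$. **Generating pairs.** For $f,g:I\to\mathbb R$ put $\mathcal D_{f,g}(x,y)=f(x)g(y)-f(y)g(x)$ and $W_{f,g}=f'g-fg'$. Write $(f,g)\in\mathcal C_3(I)$ if $f,g$ are three times continuously differentiable on $I$, $\mathcal D_{f,g}(x,y)\neq0$ for all distinct $x,y\in I$, and $W_{f,g}$ does not vanish on $I$. For such pairs set $$\Phi_{f,g}=\frac{f''g-fg''}{W_{f,g}},\qquad \Psi_{f,g}=-\frac{f''g'-f'g''}{W_{f,g}} .$$ Pairs $(f,g)$ and $(h,k)$ are called equivalent if there are $\alpha,\beta,\gamma,\delta\in\mathbb R$ with $\alpha\delta-\beta\gamma\ne0$, $f=\alpha h+\beta k$ and $g=\gamma h+\delta k$ on $I$. **Families of means.** A measurable family of $d$-variable means is a map $m:I^d\times T\to I$ such that $\min_i x_i\le m(\boldsymbol x,t)\le\max_i x_i$ for all $\boldsymbol x\in I^d$, $t\in T$, and $m(\boldsymbol x,\cdot)$ is measurable for all $\boldsymbol x\in I^d$.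 A function $\varphi:I^d\times T\to\mathbb R$ is of $L^q$-type at $\boldsymbol p\in I^d$ if $\varphi(\boldsymbol p,\cdot)$ is measurable and there are $\delta>0$ and $a\in L^q(T,\mathcal A,\mu)$ with $|\varphi(\boldsymbol x,t)|\le a(t)$ for all $t\in T$ and all $\boldsymbol x\in I^d$ with $|\boldsymbol x-\boldsymbol p|\le\delta$. Write $m\in\mathcal C_3(I^d\times T)$ if $m$ is a measurable family of $d$-variable means, $m(\cdot,t)$ is three times continuously differentiable on $I^d$ for each $t\in T$, and, at every $\boldsymbol p\in I^d$ and for all $i,j,l\in\{1,\dots,d\}$, $\partial_i m$ is of $L^1$-, $L^2$- and $L^3$-type, $\partial_i\partial_j m$ is of $L^1$- and $L^{3/2}$-type and $\partial_i\partial_j\partial_l m$ is of $L^1$-type. For such $m$ put $$\partial_i^*m(\boldsymbol x,t)=\partial_i m(\boldsymbol x,t)-\int_T\partial_i m(\boldsymbol x,s)\,d\mu(s).$$ For $\boldsymbol x\in I^d$ let $M_{f,g,m;\mu}(\boldsymbol x)$ be the unique $y\in I$ with $\int_T\mathcal D_{f,g}(m(\boldsymbol x,t),y)\,d\mu(t)=0$.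 Write $x^{(d)}=(x,\dots,x)$. **Theorem.** Let $(f,g),(h,k)\in\mathcal C_3(I)$ and $m\in\mathcal C_3(I^d\times T)$. Assume that $D\subseteq I$ is a dense subset of $I$ such that, for every $x\in D$, $$\mu\big(\{t\in T:\partial_1^*m(x^{(d)},t)=\dots=\partial_d^*m(x^{(d)},t)=0\}\big)<1$$ and there exist $i,j,l\in\{1,\dots,d\}$ with $$\int_T \partial_i^*m(x^{(d)},t)\,\partial_j^*m(x^{(d)},t)\,\partial_l^*m(x^{(d)},t)\,d\mu(t)\neq0 .$$ Then the following assertions are equivalent: (i) $M_{f,g,m;\mu}(\boldsymbol x)=M_{h,k,m;\mu}(\boldsymbol x)$ for all $\boldsymbol x\in I^d$; (ii) there is an open set $U\subseteq I^d$ containing $\{x^{(d)}: x\in D\}$ such that $M_{f,g,m;\mu}(\boldsymbol x)=M_{h,k,m;\mu}(\boldsymbol x)$ for all $\boldsymbol x\in U$; (iii) $\Phi_{f,g}=\Phi_{h,k}$ and $\Psi_{f,g}=\Psi_{h,k}$ on $I$; (iv) the pairs $(f,g)$ and $(h,k)$ are equivalent. -/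

import Mathlib

open MeasureTheory

namespace GenMean

/-- The power `I ^ d` of a set of reals. -/
def cube (I : Set ℝ) (d : ℕ) : Set (Fin d → ℝ) := {x | ∀ i, x i ∈ I}

/-- The diagonal point `(x, …, x)` of `ℝ ^ d`. -/
def diag (d : ℕ) (x : ℝ) : Fin d → ℝ := fun _ => x

/-! ### Pairs of generating functions (real functions, only their values on `I` matter) -/

/-- The determinant `f x * g y - f y * g x`. -/
noncomputable def chebDet (f g : ℝ → ℝ) (x y : ℝ) : ℝ :=
  Matrix.det !![f x, f y; g x, g y]

/-- The Wronski determinant `f' * g - f * g'`. -/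
noncomputable def wronski (f g : ℝ → ℝ) (x : ℝ) : ℝ :=
  Matrix.det !![deriv f x, f x; deriv g x, g x]

/-- The class `C_n(I)`: pairs of `n` times continuously differentiable functions on the open
interval `I` forming a Chebyshev system on `I` such that, if `n ≥ 1`, their Wronski determinant
does not vanish on `I`. -/
structure PairClass (n : ℕ) (I : Set ℝ) (f g : ℝ → ℝ) : Prop where
  contDiffOn_fst : ContDiffOn ℝ n f I
  contDiffOn_snd : ContDiffOn ℝ n g I
  chebyshev : ∀ x ∈ I, ∀ y ∈ I, x ≠ y → chebDet f g x y ≠ 0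
  wronski_ne_zero : 1 ≤ n → ∀ x ∈ I, wronski f g x ≠ 0

/-- `Φ_{f,g}`. -/
noncomputable def Phi (f g : ℝ → ℝ) (x : ℝ) : ℝ :=
  Matrix.det !![deriv (deriv f) x, f x; deriv (deriv g) x, g x] / wronski f g x

/-- `Ψ_{f,g}`. -/
noncomputable def Psi (f g : ℝ → ℝ) (x : ℝ) : ℝ :=
  -(Matrix.det !![deriv (deriv f) x, deriv f x; deriv (deriv g) x, deriv g x]) / wronski f g x

/-- The pairs `(f, g)` and `(h, k)` are equivalent on `I`. -/
def EquivPairs (I : Set ℝ) (f g h k : ℝ → ℝ) : Prop :=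
  ∃ α β γ δ : ℝ, α * δ - β * γ ≠ 0 ∧
    ∀ x ∈ I, f x = α * h x + β * k x ∧ g x = γ * h x + δ * k x

/-! ### Families of means -/

/-- `M` restricts to a `d`-variable mean `I ^ d → I`. -/
def IsMean (I : Set ℝ) {d : ℕ} (M : (Fin d → ℝ) → ℝ) : Prop :=
  ∀ x ∈ cube I d, M x ∈ I ∧ (⨅ i, x i) ≤ M x ∧ M x ≤ ⨆ i, x i

/-- The partial derivative `∂ᵢ F`. -/
noncomputable def pderiv {d : ℕ} (i : Fin d) (F : (Fin d → ℝ) → ℝ) : (Fin d → ℝ) → ℝ :=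
  fun x => fderiv ℝ F x (Pi.single i 1)

variable {T : Type*} [MeasurableSpace T]

/-- `m` is a measurable family of `d`-variable means on `I`, parametrized by `T`. -/
structure MeasurableFamily (I : Set ℝ) {d : ℕ} (m : (Fin d → ℝ) → T → ℝ) : Prop where
  isMean : ∀ t, IsMean I (fun x => m x t)
  measurable : ∀ x ∈ cube I d, Measurable (m x)

/-- `φ : I ^ d × T → ℝ` is of `L^q`-type at `p`. -/
def LqType (I : Set ℝ) {d : ℕ} (μ : Measure T) (q : ENNReal) (φ : (Fin d → ℝ) → T → ℝ)
    (p : Fin d → ℝ) : Prop :=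
  Measurable (φ p) ∧ ∃ δ > 0, ∃ a : T → ℝ, Measurable a ∧ MemLp a q μ ∧
    ∀ t, ∀ x ∈ cube I d, ‖x - p‖ ≤ δ → |φ x t| ≤ a t

/-- The class `C_1(I^d × T)` (with respect to `μ`). -/
structure FamilyClass1 (I : Set ℝ) {d : ℕ} (μ : Measure T) (m : (Fin d → ℝ) → T → ℝ) : Prop
    extends MeasurableFamily I m where
  contDiffOn_one : ∀ t, ContDiffOn ℝ 1 (fun x => m x t) (cube I d)
  lqType_one_pderiv : ∀ p ∈ cube I d, ∀ i,
    LqType I μ 1 (fun x t => pderiv i (fun y => m y t) x) p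

/-- The class `C_2(I^d × T)` (with respect to `μ`). -/
structure FamilyClass2 (I : Set ℝ) {d : ℕ} (μ : Measure T) (m : (Fin d → ℝ) → T → ℝ) : Prop
    extends FamilyClass1 I μ m where
  contDiffOn_two : ∀ t, ContDiffOn ℝ 2 (fun x => m x t) (cube I d)
  lqType_two_pderiv : ∀ p ∈ cube I d, ∀ i,
    LqType I μ 2 (fun x t => pderiv i (fun y => m y t) x) p
  lqType_one_pderiv₂ : ∀ p ∈ cube I d, ∀ i j,
    LqType I μ 1 (fun x t => pderiv i (pderiv j (fun y => m y t)) x) p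

/-- The class `C_3(I^d × T)` (with respect to `μ`). -/
structure FamilyClass3 (I : Set ℝ) {d : ℕ} (μ : Measure T) (m : (Fin d → ℝ) → T → ℝ) : Prop
    extends FamilyClass2 I μ m where
  contDiffOn_three : ∀ t, ContDiffOn ℝ 3 (fun x => m x t) (cube I d)
  lqType_three_pderiv : ∀ p ∈ cube I d, ∀ i,
    LqType I μ 3 (fun x t => pderiv i (fun y => m y t) x) p
  lqType_three_halves_pderiv₂ : ∀ p ∈ cube I d, ∀ i j,
    LqType I μ (3 / 2) (fun x t => pderiv i (pderiv j (fun y => m y t)) x) p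
  lqType_one_pderiv₃ : ∀ p ∈ cube I d, ∀ i j l,
    LqType I μ 1 (fun x t => pderiv i (pderiv j (pderiv l (fun y => m y t))) x) p

/-- The centred partial derivative `∂ᵢ* m (x, t) = ∂ᵢ m (x, t) - ∫ ∂ᵢ m (x, s) dμ(s)`. -/
noncomputable def cpderiv {d : ℕ} (μ : Measure T) (m : (Fin d → ℝ) → T → ℝ) (i : Fin d)
    (x : Fin d → ℝ) (t : T) : ℝ :=
  pderiv i (fun y => m y t) x - ∫ s, pderiv i (fun y => m y s) x ∂μ

/-- The generalized Bajraktarević mean `M_{f,g,m;μ}` at `x`: the solution `y ∈ I` of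
`∫ D_{f,g}(m(x,t), y) dμ(t) = 0`, which exists and is unique by `existsUnique_bajMean` below. -/
noncomputable def bajMean (I : Set ℝ) {d : ℕ} (f g : ℝ → ℝ) (m : (Fin d → ℝ) → T → ℝ)
    (μ : Measure T) (x : Fin d → ℝ) : ℝ :=
  Classical.epsilon fun y => y ∈ I ∧ ∫ t, chebDet f g (m x t) y ∂μ = 0

theorem sign_const {u : ℝ → ℝ} {S : Set ℝ} (hS : S.OrdConnected) (hu : ContinuousOn u S)
    (h0 : ∀ s ∈ S, u s ≠ 0) {b : ℝ} (hb : b ∈ S) : ∀ s ∈ S, 0 < u s * u b := by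
  intro s hs
  by_contra hneg
  have hpc : IsPreconnected (u '' S) := hS.isPreconnected.image u hu
  have hoc := hpc.ordConnected
  have h1 : (0 : ℝ) ∈ u '' S := by
    rcases lt_trichotomy (u b) 0 with h | h | h
    · have : 0 ≤ u s := by nlinarith
      exact hoc.out ⟨b, hb, rfl⟩ ⟨s, hs, rfl⟩ ⟨h.le, this⟩
    · exact (h0 b hb h).elim
    · have : u s ≤ 0 := by nlinarith
      exact hoc.out ⟨s, hs, rfl⟩ ⟨b, hb, rfl⟩ ⟨this, h.le⟩
  obtain ⟨z, hz, hz0⟩ := h1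
  exact h0 z hz hz0

/-- The defining equation of `M_{f,g,m;μ}(x)` has exactly one solution in `I`. -/
theorem existsUnique_bajMean {I : Set ℝ} (hIo : IsOpen I) (hIc : I.OrdConnected) {d : ℕ}
    (hd : 0 < d) {f g : ℝ → ℝ} (hfg : PairClass 0 I f g) {m : (Fin d → ℝ) → T → ℝ}
    (hm : MeasurableFamily I m) (μ : Measure T) [IsProbabilityMeasure μ]
    {x : Fin d → ℝ} (hx : x ∈ cube I d) :
    ∃! y, y ∈ I ∧ ∫ t, chebDet f g (m x t) y ∂μ = 0 := by
  have hf : ContinuousOn f I := hfg.contDiffOn_fst.continuousOn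
  have hg : ContinuousOn g I := hfg.contDiffOn_snd.continuousOn
  have : Nonempty (Fin d) := ⟨⟨0, hd⟩⟩
  set a := ⨅ i, x i with ha
  set b := ⨆ i, x i with hb
  have haI : a ∈ I := by
    obtain ⟨i, hi⟩ := exists_eq_ciInf_of_finite (f := x)
    rw [ha, ← hi]; exact hx i
  have hbI : b ∈ I := by
    obtain ⟨i, hi⟩ := exists_eq_ciSup_of_finite (f := x)
    rw [hb, ← hi]; exact hx i
  have hsub : Set.Icc a b ⊆ I := hIc.out haI hbI
  have hmm : ∀ t, m x t ∈ Set.Icc a b := fun t => (hm.isMean t x hx).2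
  have hmeas := hm.measurable x hx
  -- integrability of continuous functions of the family
  have hint : ∀ φ : ℝ → ℝ, ContinuousOn φ I → Integrable (fun t => φ (m x t)) μ := by
    intro φ hφ
    have hφ' := hφ.mono hsub
    obtain ⟨C, hC⟩ := isCompact_Icc.exists_bound_of_continuousOn hφ'
    have hφm : Measurable ((Set.Icc a b).indicator φ) := by
      have := (hφ'.measurable_piecewise (g := (0 : ℝ → ℝ)) continuousOn_const
        measurableSet_Icc)
      rwa [Set.piecewise_eq_indicator] at this
    have he : (fun t => φ (m x t)) = fun t => (Set.Icc a b).indicator φ (m x t) := by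
      funext t; rw [Set.indicator_of_mem (hmm t)]
    refine Integrable.of_bound (C := C) ?_ (Filter.Eventually.of_forall fun t => hC _ (hmm t))
    rw [he]
    exact (hφm.comp hmeas).aestronglyMeasurable
  have hD : ∀ u v, chebDet f g u v = f u * g v - f v * g u := by
    intro u v; simp [chebDet, Matrix.det_fin_two_of]
  set A := ∫ t, f (m x t) ∂μ with hA
  set B := ∫ t, g (m x t) ∂μ with hB
  have hF : ∀ y, ∫ t, chebDet f g (m x t) y ∂μ = A * g y - f y * B := by
    intro y
    simp only [hD]
    rw [integral_sub ((hint f hf).mul_const _) ((hint g hg).const_mul _), integral_mul_const,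
      integral_const_mul]
  have hab : a ≤ b := by
    obtain ⟨t⟩ : Nonempty T := nonempty_of_isProbabilityMeasure μ
    exact (hmm t).1.trans (hmm t).2
  have hcD : ∀ y, ContinuousOn (fun s => chebDet f g s y) I := by
    intro y; simp only [hD]; fun_prop
  have hiD : ∀ y, Integrable (fun t => chebDet f g (m x t) y) μ := fun y => hint _ (hcD y)
  -- a second point of the interval, so that `f` and `g` have no common zero
  have hnz : ∀ y ∈ I, ¬ (f y = 0 ∧ g y = 0) := by
    rintro y hy ⟨h1, h2⟩
    obtain ⟨ε, hε, hball⟩ := Metric.isOpen_iff.1 hIo y hy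
    have hz : y + ε / 2 ∈ I := hball (by
      rw [Metric.mem_ball, Real.dist_eq, add_sub_cancel_left, abs_of_pos (by linarith)]; linarith)
    refine hfg.chebyshev y hy _ hz (by linarith) ?_
    rw [hD, h1, h2]; ring
  by_cases hab' : a = b
  · have hmc : ∀ t, m x t = a := fun t => le_antisymm (hab' ▸ (hmm t).2) (hmm t).1
    have hFa : ∀ y, ∫ t, chebDet f g (m x t) y ∂μ = chebDet f g a y := by
      intro y; simp [hmc]
    refine ⟨a, ⟨haI, by rw [hFa, hD]; ring⟩, ?_⟩
    rintro y ⟨hy, hy0⟩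
    by_contra hne
    rw [hFa] at hy0
    exact hfg.chebyshev a haI y hy (Ne.symm hne) hy0
  have hlt : a < b := lt_of_le_of_ne hab hab'
  have hba0 : chebDet f g b a ≠ 0 := hfg.chebyshev b hbI a haI hlt.ne'
  -- signs at the end points
  have hsa : ∀ s ∈ Set.Ioc a b, 0 < chebDet f g s a * chebDet f g b a :=
    sign_const (u := fun s => chebDet f g s a) Set.ordConnected_Ioc
      ((hcD a).mono fun s hs => hsub ⟨hs.1.le, hs.2⟩)
      (fun s hs => hfg.chebyshev s (hsub ⟨hs.1.le, hs.2⟩) a haI hs.1.ne') ⟨hlt, le_rfl⟩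
  have hsb : ∀ s ∈ Set.Ico a b, 0 < chebDet f g s b * chebDet f g a b :=
    sign_const (u := fun s => chebDet f g s b) Set.ordConnected_Ico
      ((hcD b).mono fun s hs => hsub ⟨hs.1, hs.2.le⟩)
      (fun s hs => hfg.chebyshev s (hsub ⟨hs.1, hs.2.le⟩) b hbI hs.2.ne) ⟨le_rfl, hlt⟩
  have hself : ∀ y, chebDet f g y y = 0 := fun y => by rw [hD]; ring
  have hanti : chebDet f g a b = - chebDet f g b a := by rw [hD, hD]; ring
  have hpa : ∀ t, 0 ≤ chebDet f g (m x t) a * chebDet f g b a := by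
    intro t
    rcases (hmm t).1.eq_or_lt with h | h
    · rw [← h, hself, zero_mul]
    · exact (hsa _ ⟨h, (hmm t).2⟩).le
  have hpb : ∀ t, 0 ≤ chebDet f g (m x t) b * chebDet f g a b := by
    intro t
    rcases (hmm t).2.eq_or_lt with h | h
    · rw [h, hself, zero_mul]
    · exact (hsb _ ⟨(hmm t).1, h⟩).le
  have hIa : 0 ≤ (A * g a - f a * B) * chebDet f g b a := by
    rw [← hF, ← integral_mul_const]; exact integral_nonneg hpa
  have hIb : (A * g b - f b * B) * chebDet f g b a ≤ 0 := by
    have : 0 ≤ (A * g b - f b * B) * chebDet f g a b := by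
      rw [← hF, ← integral_mul_const]; exact integral_nonneg hpb
    rw [hanti] at this; linarith
  have hex : ∃ y ∈ Set.Icc a b, (A * g y - f y * B) * chebDet f g b a = 0 := by
    have hc : ContinuousOn (fun y => (A * g y - f y * B) * chebDet f g b a) (Set.Icc a b) := by
      have := hf.mono hsub
      have := hg.mono hsub
      fun_prop
    exact intermediate_value_Icc' hab hc ⟨hIb, hIa⟩
  obtain ⟨y, hy, hy0⟩ := hex
  have hy0' : A * g y - f y * B = 0 := (mul_eq_zero.1 hy0).resolve_right hba0
  refine ⟨y, ⟨hsub hy, by rw [hF, hy0']⟩, ?_⟩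
  rintro z ⟨hz, hz0⟩
  rw [hF] at hz0
  by_contra hne
  have hdet := hfg.chebyshev z hz y (hsub hy) hne
  rw [hD] at hdet
  have hA0 : A = 0 := by
    have : A * (f z * g y - f y * g z) = 0 := by linear_combination f z * hy0' - f y * hz0
    exact (mul_eq_zero.1 this).resolve_right hdet
  have hB0 : B = 0 := by
    have : B * (f z * g y - f y * g z) = 0 := by linear_combination g z * hy0' - g y * hz0
    exact (mul_eq_zero.1 this).resolve_right hdet
  -- then `m x t = a` almost everywhere, a contradiction
  have hint0 : ∫ t, chebDet f g (m x t) a * chebDet f g b a ∂μ = 0 := by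
    rw [integral_mul_const, hF, hA0, hB0]; ring
  have hae := (integral_eq_zero_iff_of_nonneg hpa ((hiD a).mul_const _)).1 hint0
  have hae' : ∀ᵐ t ∂μ, m x t = a := by
    filter_upwards [hae] with t ht
    by_contra hne'
    have h := hsa _ ⟨lt_of_le_of_ne (hmm t).1 (Ne.symm hne'), (hmm t).2⟩
    simp only [Pi.zero_apply] at ht
    exact h.ne' ht
  have hfa : A = f a := by
    rw [hA, integral_congr_ae (g := fun _ => f a) (hae'.mono fun t ht => by simp [ht])]; simp
  have hga : B = g a := by
    rw [hB, integral_congr_ae (g := fun _ => g a) (hae'.mono fun t ht => by simp [ht])]; simp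
  exact hnz a haI ⟨hfa ▸ hA0, hga ▸ hB0⟩

end GenMean

/-! The substance is the passage from local equality of the means to equality of `Phi` and `Psi`.
Fix `x₀ ∈ D` and a direction `v`, and write the values `m (x₀ + s v, t)` as `x₀ + s Q(s, t)` and the
common mean as `x₀ + s η(s)`. The mean property bounds `Q` and `η` by `‖v‖`, uniformly in `t`.

The combination `W_{h,k}(y) D_{f,g}(z, y) - W_{f,g}(y) D_{h,k}(z, y)` (`bracketDiff`) vanishes to
second order at `z = y`, and its integral at `y = x₀ + s η(s)`, `z = x₀ + s Q(s, t)` is zero.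
Dividing by `s ^ n` and letting `s → 0` (`tendsto_moment_of_integral_eq_zero`) shows that its first
nontrivial diagonal derivative times the `n`-th moment of the centred directional derivative is zero
(`bracketDiff_mul_moment_eq_zero`). Thus the mean itself is only expanded to first order.

For `n = 2` the coefficient is a nonzero multiple of the difference of the `Phi`. Once these agree
on `I`, the coefficient for `n = 3` is a nonzero multiple of the difference of the `Psi`.
Polarization gives a `v` with nonzero third moment, hence also nonzero second moment; density of `D`
and continuity do the rest.

Conversely, equal invariants make all four functions solutions of the same equation `u'' = Φ u' + Ψ
u`, so the pairs are equivalent (`PairClass.equivPairs`); and a linear change of the pair multiplies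
the determinant by a nonzero constant, which leaves the mean unchanged. -/

namespace GenMean

open Filter Topology

/-! ### Taylor expansion at the diagonal and limits of moments. -/

/-- Taylor expansion of a parametrized function at the diagonal, locally uniform in the parameter:
`G j y` is the `j`-th derivative of `G 0 y`. -/
theorem exists_ball_taylor_diag {I : Set ℝ} (hIo : IsOpen I) {x₀ : ℝ} (hx₀ : x₀ ∈ I) (n : ℕ) :
    ∀ G : ℕ → ℝ → ℝ → ℝ,
      (∀ j < n, ∀ y ∈ I, ∀ z ∈ I, HasDerivAt (G j y) (G (j + 1) y z) z) →
      (∀ j < n, ∀ y ∈ I, G j y y = 0) →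
      ContinuousAt (fun p : ℝ × ℝ => G n p.1 p.2) (x₀, x₀) →
      ∀ ε > 0, ∃ δ > 0, ∀ y ∈ Metric.ball x₀ δ, ∀ z ∈ Metric.ball x₀ δ,
        |G 0 y z - G n x₀ x₀ / n.factorial * (z - y) ^ n| ≤ ε * |z - y| ^ n := by
  induction n with
  | zero =>
    intro G _ _ hc ε hε
    obtain ⟨δ, hδ, h⟩ := Metric.continuousAt_iff.1 hc ε hε
    refine ⟨δ, hδ, fun y hy z hz => ?_⟩
    have := h (x := (y, z)) (by rw [Prod.dist_eq]; exact max_lt hy hz)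
    rw [Real.dist_eq] at this
    simpa using this.le
  | succ n ih =>
    intro G hG h0 hc ε hε
    -- The induction hypothesis is applied to the `z`-derivative of `G 0`; the mean value inequality
    -- on the segment from `y` to `z` then raises the order by one.
    obtain ⟨δ, hδ, h⟩ := ih (fun j => G (j + 1)) (fun j hj => hG (j + 1) (by omega))
      (fun j hj => h0 (j + 1) (by omega)) hc ε hε
    obtain ⟨r, hr, hrI⟩ := Metric.isOpen_iff.1 hIo x₀ hx₀
    refine ⟨min δ r, lt_min hδ hr, fun y hy z hz => ?_⟩
    have hsub : Set.uIcc y z ⊆ Metric.ball x₀ (min δ r) := by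
      rw [← segment_eq_uIcc]
      exact (convex_ball x₀ (min δ r)).segment_subset hy hz
    have hyI : y ∈ I := hrI (Metric.ball_subset_ball (min_le_right _ _) hy)
    have hder : ∀ w ∈ Set.uIcc y z, HasDerivWithinAt
        (fun w => G 0 y w - G (n + 1) x₀ x₀ / (n + 1).factorial * (w - y) ^ (n + 1))
        (G 1 y w - G (n + 1) x₀ x₀ / n.factorial * (w - y) ^ n) (Set.uIcc y z) w := by
      intro w hw
      have h1 := hG 0 (by omega) y hyI w
        (hrI (Metric.ball_subset_ball (min_le_right _ _) (hsub hw)))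
      have h2 := (((hasDerivAt_id w).sub_const y).pow (n + 1)).const_mul
        (G (n + 1) x₀ x₀ / (n + 1).factorial)
      have : (n.factorial : ℝ) ≠ 0 := by positivity
      refine ((h1.sub h2).congr_deriv ?_).hasDerivWithinAt
      simp [Nat.factorial_succ]
      field_simp
    have hb : ∀ w ∈ Set.uIcc y z,
        ‖G 1 y w - G (n + 1) x₀ x₀ / n.factorial * (w - y) ^ n‖ ≤ ε * |z - y| ^ n := by
      intro w hw
      have h1 := h y (Metric.ball_subset_ball (min_le_left _ _) hy) w
        (Metric.ball_subset_ball (min_le_left _ _) (hsub hw))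
      have h2 : |w - y| ≤ |z - y| := Set.abs_sub_left_of_mem_uIcc hw
      refine h1.trans ?_
      gcongr
    have h3 := (convex_uIcc y z).norm_image_sub_le_of_norm_hasDerivWithin_le hder hb
      Set.left_mem_uIcc Set.right_mem_uIcc
    have h4 := h0 0 (by omega) y hyI
    simp only [h4, sub_self, ne_eq, Nat.succ_ne_zero, not_false_eq_true, zero_pow, mul_zero,
      sub_zero, Real.norm_eq_abs] at h3
    rw [pow_succ |z - y|, ← mul_assoc]
    simpa [h4] using h3

variable {T : Type*} [MeasurableSpace T]

/-- If `∫ G(x₀ + s η(s), x₀ + s Q(s, t)) dμ(t) = 0` for a function `G` vanishing to order `n` on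
the diagonal, with `Q` and `η` bounded, then the `n`-th moments of `Q(s, ·) - η(s)` tend to zero,
up to the factor given by the `n`-th derivative of `G`. -/
theorem tendsto_moment_of_integral_eq_zero (μ : Measure T) [IsProbabilityMeasure μ]
    {I : Set ℝ} (hIo : IsOpen I) {x₀ : ℝ} (hx₀ : x₀ ∈ I) (n : ℕ) (G : ℕ → ℝ → ℝ → ℝ)
    (hG : ∀ j < n, ∀ y ∈ I, ∀ z ∈ I, HasDerivAt (G j y) (G (j + 1) y z) z)
    (h0 : ∀ j < n, ∀ y ∈ I, G j y y = 0)
    (hc : ContinuousAt (fun p : ℝ × ℝ => G n p.1 p.2) (x₀, x₀))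
    {K : ℝ} (Q : ℝ → T → ℝ) (η : ℝ → ℝ)
    (hQm : ∀ᶠ s in 𝓝[>] (0 : ℝ), Measurable (Q s))
    (hQ : ∀ᶠ s in 𝓝[>] (0 : ℝ), ∀ t, |Q s t| ≤ K) (hη : ∀ᶠ s in 𝓝[>] (0 : ℝ), |η s| ≤ K)
    (hi : ∀ᶠ s in 𝓝[>] (0 : ℝ), Integrable (fun t => G 0 (x₀ + s * η s) (x₀ + s * Q s t)) μ)
    (hz : ∀ᶠ s in 𝓝[>] (0 : ℝ), ∫ t, G 0 (x₀ + s * η s) (x₀ + s * Q s t) ∂μ = 0) :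
    Tendsto (fun s => G n x₀ x₀ * ∫ t, (Q s t - η s) ^ n ∂μ) (𝓝[>] 0) (𝓝 0) := by
  have hfac : (0 : ℝ) < n.factorial := by positivity
  -- With Taylor error `e / (2 * C)` the final error is at most `e / 2`; the summand `1` keeps `C`
  -- positive when `K = 0`.
  set C : ℝ := n.factorial * ((K + K) ^ n + 1) with hC
  have hK : 0 ≤ K := by
    obtain ⟨s, hs⟩ := hη.exists
    exact (abs_nonneg _).trans hs
  have hC0 : 0 < C := by positivity
  rw [Metric.tendsto_nhds]
  intro e he
  obtain ⟨δ, hδ, h⟩ := exists_ball_taylor_diag hIo hx₀ n G hG h0 hc (e / (2 * C)) (by positivity)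
  have hs1 : ∀ᶠ s in 𝓝[>] (0 : ℝ), s * K < δ := by
    have : Tendsto (fun s : ℝ => s * K) (𝓝[>] 0) (𝓝 0) := by
      have h1 : Continuous fun s : ℝ => s * K := by fun_prop
      have := h1.tendsto 0
      simp only [zero_mul] at this
      exact this.mono_left nhdsWithin_le_nhds
    exact this.eventually (gt_mem_nhds hδ)
  filter_upwards [hQm, hQ, hη, hi, hz, hs1, self_mem_nhdsWithin] with s hQm hQ hη hi hz hs1 hs0
  have hs0 : 0 < s := hs0
  have hmem : ∀ u : ℝ, |u| ≤ K → x₀ + s * u ∈ Metric.ball x₀ δ := by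
    intro u hu
    rw [Metric.mem_ball, Real.dist_eq, add_sub_cancel_left, abs_mul, abs_of_pos hs0]
    exact (mul_le_mul_of_nonneg_left hu hs0.le).trans_lt hs1
  have hdiff : ∀ t, |Q s t - η s| ≤ K + K := fun t =>
    (abs_sub _ _).trans (add_le_add (hQ t) hη)
  set L := G n x₀ x₀ with hL
  have hb : ∀ t, ‖G 0 (x₀ + s * η s) (x₀ + s * Q s t) - L / n.factorial * s ^ n *
      (Q s t - η s) ^ n‖ ≤ e / (2 * C) * s ^ n * (K + K) ^ n := by
    intro t
    have h1 := h _ (hmem _ hη) _ (hmem _ (hQ t))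
    have h2 : x₀ + s * Q s t - (x₀ + s * η s) = s * (Q s t - η s) := by ring
    rw [h2, mul_pow, abs_mul, mul_pow, abs_of_pos hs0] at h1
    rw [Real.norm_eq_abs, mul_assoc (L / _), mul_assoc (e / _)]
    refine h1.trans ?_
    have := hdiff t
    gcongr
  have hint : Integrable (fun t => (Q s t - η s) ^ n) μ := by
    refine Integrable.of_bound (C := (K + K) ^ n) (by fun_prop) (Eventually.of_forall fun t => ?_)
    rw [norm_pow]
    exact pow_le_pow_left₀ (norm_nonneg _) (hdiff t) n
  have hI := norm_integral_le_of_norm_le_const (μ := μ) (Eventually.of_forall hb)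
  -- The integral of `G 0` drops out, so the Taylor remainder alone bounds the main term; both sides
  -- carry a factor `s ^ n`, which cancels below.
  rw [integral_sub hi (hint.const_mul _), hz, integral_const_mul] at hI
  simp only [zero_sub, norm_neg, probReal_univ, mul_one] at hI
  have hsn : 0 < s ^ n := by positivity
  rw [dist_zero_right]
  have h5 : L / n.factorial * s ^ n * ∫ t, (Q s t - η s) ^ n ∂μ
      = s ^ n / n.factorial * (L * ∫ t, (Q s t - η s) ^ n ∂μ) := by ring
  rw [h5, norm_mul, Real.norm_of_nonneg (by positivity)] at hI
  have h6 : ‖L * ∫ t, (Q s t - η s) ^ n ∂μ‖ ≤ e / (2 * C) * (n.factorial * (K + K) ^ n) := by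
    have h7 : s ^ n / n.factorial * ‖L * ∫ t, (Q s t - η s) ^ n ∂μ‖ ≤
        s ^ n / n.factorial * (e / (2 * C) * (n.factorial * (K + K) ^ n)) := by
      refine hI.trans (le_of_eq ?_)
      field_simp
    exact le_of_mul_le_mul_left h7 (by positivity)
  have h8 : (n.factorial * (K + K) ^ n : ℝ) ≤ C := by rw [hC]; nlinarith
  calc _ ≤ e / (2 * C) * (n.factorial * (K + K) ^ n) := h6
    _ ≤ e / (2 * C) * C := by gcongr
    _ = e / 2 := by field_simp
    _ < e := by linarith

/-! ### Localization, bounds and integrability for means. -/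

theorem isOpen_cube {I : Set ℝ} (hIo : IsOpen I) (d : ℕ) : IsOpen (cube I d) := by
  have : cube I d = Set.univ.pi fun _ => I := by ext x; simp [cube]
  rw [this]
  exact isOpen_set_pi Set.finite_univ fun _ _ => hIo

theorem chebDet_apply (f g : ℝ → ℝ) (x y : ℝ) : chebDet f g x y = f x * g y - f y * g x := by
  simp [chebDet, Matrix.det_fin_two_of]

theorem wronski_apply (f g : ℝ → ℝ) (x : ℝ) :
    wronski f g x = deriv f x * g x - f x * deriv g x := by
  simp [wronski, Matrix.det_fin_two_of]

theorem PairClass.mono_zero {n : ℕ} {I J : Set ℝ} (hJ : J ⊆ I) {f g : ℝ → ℝ}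
    (h : PairClass n I f g) : PairClass 0 J f g where
  contDiffOn_fst := (h.contDiffOn_fst.of_le (by simp)).mono hJ
  contDiffOn_snd := (h.contDiffOn_snd.of_le (by simp)).mono hJ
  chebyshev x hx y hy := h.chebyshev x (hJ hx) y (hJ hy)
  wronski_ne_zero h1 := absurd h1 (by norm_num)

/-- A mean of points of a subinterval stays in that subinterval. This allows the existence theorem
for `bajMean` to be applied on small intervals. -/
theorem MeasurableFamily.mono {I J : Set ℝ} (hJ : J ⊆ I) (hJc : J.OrdConnected) {d : ℕ}
    (hd : 0 < d) {m : (Fin d → ℝ) → T → ℝ} (hm : MeasurableFamily I m) :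
    MeasurableFamily J m where
  isMean t x hx := by
    have : Nonempty (Fin d) := ⟨⟨0, hd⟩⟩
    have h := hm.isMean t x fun i => hJ (hx i)
    refine ⟨?_, h.2⟩
    obtain ⟨i, hi⟩ := exists_eq_ciInf_of_finite (f := x)
    obtain ⟨j, hj⟩ := exists_eq_ciSup_of_finite (f := x)
    exact hJc.out (hx i) (hx j) ⟨hi ▸ h.2.1, hj ▸ h.2.2⟩
  measurable x hx := hm.measurable x fun i => hJ (hx i)

/-- The value lies between the smallest and the largest coordinate, and both are within the sup norm
distance of `x₀`. The bound is uniform in `t`, which later supplies the dominating functions. -/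
theorem MeasurableFamily.dist_le {I : Set ℝ} {d : ℕ} (hd : 0 < d) {m : (Fin d → ℝ) → T → ℝ}
    (hm : MeasurableFamily I m) {x : Fin d → ℝ} (hx : x ∈ cube I d) (x₀ : ℝ) (t : T) :
    |m x t - x₀| ≤ ‖x - diag d x₀‖ := by
  have : Nonempty (Fin d) := ⟨⟨0, hd⟩⟩
  have h := (hm.isMean t x hx).2
  obtain ⟨i, hi⟩ := exists_eq_ciInf_of_finite (f := x)
  obtain ⟨j, hj⟩ := exists_eq_ciSup_of_finite (f := x)
  have h1 := abs_le.1 (norm_le_pi_norm (x - diag d x₀) i)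
  have h2 := abs_le.1 (norm_le_pi_norm (x - diag d x₀) j)
  simp only [Pi.sub_apply, diag] at h1 h2
  rw [← hi, ← hj] at h
  exact abs_le.2 ⟨by linarith [h.1], by linarith [h.2]⟩

/-- The family takes its values between two coordinates of `x`, a compact interval on which `φ` is
bounded. The indicator is needed for measurability because `φ` is controlled only on `I`. -/
theorem MeasurableFamily.integrable_comp {I : Set ℝ} (hIo : IsOpen I) (hIc : I.OrdConnected)
    {d : ℕ} (hd : 0 < d) {m : (Fin d → ℝ) → T → ℝ} (hm : MeasurableFamily I m) (μ : Measure T)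
    [IsFiniteMeasure μ] {x : Fin d → ℝ} (hx : x ∈ cube I d) {φ : ℝ → ℝ} (hφ : ContinuousOn φ I) :
    Integrable (fun t => φ (m x t)) μ := by
  classical
  have : Nonempty (Fin d) := ⟨⟨0, hd⟩⟩
  obtain ⟨i, hi⟩ := exists_eq_ciInf_of_finite (f := x)
  obtain ⟨j, hj⟩ := exists_eq_ciSup_of_finite (f := x)
  obtain ⟨C, hC⟩ := isCompact_Icc.exists_bound_of_continuousOn (hφ.mono (hIc.out (hx i) (hx j)))
  have hφm : Measurable (I.indicator φ) := by
    have := hφ.measurable_piecewise (g := (0 : ℝ → ℝ)) continuousOn_const hIo.measurableSet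
    rwa [Set.piecewise_eq_indicator] at this
  have he : (fun t => φ (m x t)) = fun t => I.indicator φ (m x t) := by
    funext t; rw [Set.indicator_of_mem (hm.isMean t x hx).1]
  refine Integrable.of_bound (C := C) ?_ (Eventually.of_forall fun t => hC _ ?_)
  · rw [he]
    exact (hφm.comp (hm.measurable x hx)).aestronglyMeasurable
  · rw [hi, hj]
    exact (hm.isMean t x hx).2

theorem bajMean_spec {I : Set ℝ} (hIo : IsOpen I) (hIc : I.OrdConnected) {d : ℕ}
    (hd : 0 < d) {f g : ℝ → ℝ} (hfg : PairClass 0 I f g) {m : (Fin d → ℝ) → T → ℝ}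
    (hm : MeasurableFamily I m) (μ : Measure T) [IsProbabilityMeasure μ]
    {x : Fin d → ℝ} (hx : x ∈ cube I d) :
    bajMean I f g m μ x ∈ I ∧ ∫ t, chebDet f g (m x t) (bajMean I f g m μ x) ∂μ = 0 :=
  Classical.epsilon_spec (existsUnique_bajMean hIo hIc hd hfg hm μ hx).exists

/-- Solving the defining equation in the smaller interval `I ∩ ball x₀ r` gives a point which, by
uniqueness in `I`, is `bajMean` itself. -/
theorem bajMean_dist_le {I : Set ℝ} (hIo : IsOpen I) (hIc : I.OrdConnected) {d : ℕ}
    (hd : 0 < d) {f g : ℝ → ℝ} (hfg : PairClass 0 I f g) {m : (Fin d → ℝ) → T → ℝ}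
    (hm : MeasurableFamily I m) (μ : Measure T) [IsProbabilityMeasure μ]
    {x : Fin d → ℝ} (hx : x ∈ cube I d) (x₀ : ℝ) :
    |bajMean I f g m μ x - x₀| ≤ ‖x - diag d x₀‖ := by
  -- The ball is open, so the radius has to exceed the norm strictly; the bound follows by letting
  -- `r` decrease to it.
  refine le_of_forall_gt_imp_ge_of_dense fun r hr => ?_
  have hJ : I ∩ Metric.ball x₀ r ⊆ I := Set.inter_subset_left
  have hJc : (I ∩ Metric.ball x₀ r).OrdConnected :=
    hIc.inter (convex_ball x₀ r).ordConnected
  have hxJ : x ∈ cube (I ∩ Metric.ball x₀ r) d := fun i =>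
    ⟨hx i, (norm_le_pi_norm (x - diag d x₀) i).trans_lt hr⟩
  obtain ⟨y, ⟨hy, hy0⟩, -⟩ := existsUnique_bajMean (hIo.inter Metric.isOpen_ball) hJc hd
    (hfg.mono_zero hJ) (hm.mono hJ hJc hd) μ hxJ
  rw [(existsUnique_bajMean hIo hIc hd hfg hm μ hx).unique
    (bajMean_spec hIo hIc hd hfg hm μ hx) ⟨hJ hy, hy0⟩]
  exact (Metric.mem_ball.1 hy.2).le

/-- Equivalent pairs of functions generate the same mean. -/
theorem EquivPairs.bajMean_eq {I : Set ℝ} {d : ℕ} {f g h k : ℝ → ℝ} (he : EquivPairs I f g h k)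
    {m : (Fin d → ℝ) → T → ℝ} (hm : MeasurableFamily I m) (μ : Measure T) {x : Fin d → ℝ}
    (hx : x ∈ cube I d) : bajMean I f g m μ x = bajMean I h k m μ x := by
  obtain ⟨α, β, γ, δ, hdet, heq⟩ := he
  unfold bajMean
  -- `Classical.epsilon` depends only on the predicate, so equivalence of the two defining
  -- conditions suffices.
  congr 1
  funext y
  refine propext (and_congr_right fun hy => ?_)
  have : ∀ t, chebDet f g (m x t) y = (α * δ - β * γ) * chebDet h k (m x t) y := by
    intro t
    obtain ⟨h1, h2⟩ := heq _ (hm.isMean t x hx).1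
    obtain ⟨h3, h4⟩ := heq y hy
    rw [chebDet_apply, chebDet_apply, h1, h2, h3, h4]
    ring
  simp only [this, integral_const_mul, mul_eq_zero, hdet, false_or]

/-! ### Derivatives of the generating functions -/

theorem _root_.ContDiffOn.hasDerivAt_iterate_deriv {n : ℕ} {I : Set ℝ} (hIo : IsOpen I) :
    ∀ {f : ℝ → ℝ}, ContDiffOn ℝ n f I → ∀ j < n, ∀ z ∈ I,
      HasDerivAt (deriv^[j] f) (deriv^[j + 1] f z) z := by
  induction n with
  | zero => intro f _ j hj; omega
  | succ n ih =>
    intro f hf j hj z hz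
    have h := (contDiffOn_succ_iff_deriv_of_isOpen (n := n) hIo).1 (by exact_mod_cast hf)
    rcases j with _ | j
    · exact ((h.1 z hz).differentiableAt (hIo.mem_nhds hz)).hasDerivAt
    · exact ih h.2.2 j (by omega) z hz

theorem _root_.ContDiffOn.continuousOn_iterate_deriv {n : ℕ} {I : Set ℝ} (hIo : IsOpen I) :
    ∀ {f : ℝ → ℝ}, ContDiffOn ℝ n f I → ∀ j ≤ n, ContinuousOn (deriv^[j] f) I := by
  induction n with
  | zero =>
    intro f hf j hj
    obtain rfl : j = 0 := by omega
    exact hf.continuousOn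
  | succ n ih =>
    intro f hf j hj
    have h := (contDiffOn_succ_iff_deriv_of_isOpen (n := n) hIo).1 (by exact_mod_cast hf)
    rcases j with _ | j
    · exact hf.continuousOn
    · exact ih h.2.2 j (by omega)

/-- The `j`-th derivative with respect to `z` of `chebDet f g z y`. -/
noncomputable def bracket (f g : ℝ → ℝ) (j : ℕ) (y z : ℝ) : ℝ :=
  deriv^[j] f z * g y - deriv^[j] g z * f y

theorem bracket_zero (f g : ℝ → ℝ) (y z : ℝ) : bracket f g 0 y z = chebDet f g z y := by
  rw [chebDet_apply, bracket]; simp; ring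

theorem bracket_one_self (f g : ℝ → ℝ) (y : ℝ) : bracket f g 1 y y = wronski f g y := by
  rw [wronski_apply, bracket]; simp; ring

theorem PairClass.hasDerivAt_bracket {n : ℕ} {I : Set ℝ} (hIo : IsOpen I) {f g : ℝ → ℝ}
    (hfg : PairClass n I f g) {j : ℕ} (hj : j < n) (y : ℝ) {z : ℝ} (hz : z ∈ I) :
    HasDerivAt (bracket f g j y) (bracket f g (j + 1) y z) z :=
  ((hfg.contDiffOn_fst.hasDerivAt_iterate_deriv hIo j hj z hz).mul_const _).sub
    ((hfg.contDiffOn_snd.hasDerivAt_iterate_deriv hIo j hj z hz).mul_const _)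

theorem PairClass.continuousAt_bracket {n : ℕ} {I : Set ℝ} (hIo : IsOpen I) {f g : ℝ → ℝ}
    (hfg : PairClass n I f g) {j : ℕ} (hj : j ≤ n) {y z : ℝ} (hy : y ∈ I) (hz : z ∈ I) :
    ContinuousAt (fun p : ℝ × ℝ => bracket f g j p.1 p.2) (y, z) := by
  have h1 := (hfg.contDiffOn_fst.continuousOn_iterate_deriv hIo j hj).continuousAt
    (hIo.mem_nhds hz)
  have h2 := (hfg.contDiffOn_snd.continuousOn_iterate_deriv hIo j hj).continuousAt
    (hIo.mem_nhds hz)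
  have h3 := hfg.contDiffOn_fst.continuousOn.continuousAt (hIo.mem_nhds hy)
  have h4 := hfg.contDiffOn_snd.continuousOn.continuousAt (hIo.mem_nhds hy)
  exact (((ContinuousAt.comp' (f := Prod.snd) h1 continuousAt_snd)).mul
    (ContinuousAt.comp' (f := Prod.fst) h4 continuousAt_fst)).sub
    (((ContinuousAt.comp' (f := Prod.snd) h2 continuousAt_snd)).mul
    (ContinuousAt.comp' (f := Prod.fst) h3 continuousAt_fst))

theorem PairClass.continuousAt_wronski {n : ℕ} (hn : 1 ≤ n) {I : Set ℝ} (hIo : IsOpen I)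
    {f g : ℝ → ℝ} (hfg : PairClass n I f g) {y : ℝ} (hy : y ∈ I) :
    ContinuousAt (wronski f g) y := by
  have h := (hfg.continuousAt_bracket hIo hn hy hy).comp (f := fun y => (y, y))
    (continuousAt_id.prodMk continuousAt_id)
  exact h.congr (Eventually.of_forall fun y => bracket_one_self f g y)

/-- The `j`-th derivative with respect to `z` of the difference of the determinants of two pairs,
scaled such that it vanishes to second order at `z = y`. -/
noncomputable def bracketDiff (f g h k : ℝ → ℝ) (j : ℕ) (y z : ℝ) : ℝ :=
  wronski h k y * bracket f g j y z - wronski f g y * bracket h k j y z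

theorem bracketDiff_zero_self (f g h k : ℝ → ℝ) (y : ℝ) : bracketDiff f g h k 0 y y = 0 := by
  simp [bracketDiff, bracket_zero, chebDet_apply]

theorem bracketDiff_one_self (f g h k : ℝ → ℝ) (y : ℝ) : bracketDiff f g h k 1 y y = 0 := by
  simp [bracketDiff, bracket_one_self, mul_comm]

theorem Phi_eq (f g : ℝ → ℝ) (x : ℝ) : Phi f g x = bracket f g 2 x x / wronski f g x := by
  simp [Phi, bracket, Matrix.det_fin_two_of]; ring

theorem Psi_eq (f g : ℝ → ℝ) (x : ℝ) : Psi f g x =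
    -(deriv (deriv f) x * deriv g x - deriv f x * deriv (deriv g) x) / wronski f g x := by
  simp [Psi, Matrix.det_fin_two_of]

theorem bracketDiff_two_self {I : Set ℝ} {f g h k : ℝ → ℝ} (hfg : PairClass 3 I f g)
    (hhk : PairClass 3 I h k) {x : ℝ} (hx : x ∈ I) : bracketDiff f g h k 2 x x =
      wronski f g x * wronski h k x * (Phi f g x - Phi h k x) := by
  have h1 := hfg.wronski_ne_zero (by norm_num) x hx
  have h2 := hhk.wronski_ne_zero (by norm_num) x hx
  rw [Phi_eq, Phi_eq, bracketDiff]
  field_simp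

/-- The products of first derivatives cancel, so that `W' = Φ W`. This serves both the third order
computation and the integration of the differential equation. -/
theorem PairClass.hasDerivAt_wronski {I : Set ℝ} (hIo : IsOpen I) {f g : ℝ → ℝ}
    (hfg : PairClass 3 I f g) {x : ℝ} (hx : x ∈ I) :
    HasDerivAt (wronski f g) (bracket f g 2 x x) x := by
  have f0 := hfg.contDiffOn_fst.hasDerivAt_iterate_deriv hIo 0 (by norm_num) x hx
  have g0 := hfg.contDiffOn_snd.hasDerivAt_iterate_deriv hIo 0 (by norm_num) x hx
  have f1 := hfg.contDiffOn_fst.hasDerivAt_iterate_deriv hIo 1 (by norm_num) x hx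
  have g1 := hfg.contDiffOn_snd.hasDerivAt_iterate_deriv hIo 1 (by norm_num) x hx
  have he : wronski f g = fun x => deriv f x * g x - f x * deriv g x :=
    funext (wronski_apply f g)
  rw [he]
  refine ((f1.mul g0).sub (f0.mul g1)).congr_deriv ?_
  simp [bracket]
  ring

/-- If `Φ` agrees for both pairs, the third derivative compares the values of `Ψ`. -/
theorem bracketDiff_three_self {I : Set ℝ} (hIo : IsOpen I) {f g h k : ℝ → ℝ}
    (hfg : PairClass 3 I f g) (hhk : PairClass 3 I h k)
    (hΦ : ∀ x ∈ I, Phi f g x = Phi h k x) {x : ℝ} (hx : x ∈ I) : bracketDiff f g h k 3 x x =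
      wronski f g x * wronski h k x * (Psi f g x - Psi h k x) := by
  -- Along the diagonal both arguments of the bracket move; the extra term is `-Ψ W`.
  have hd : ∀ {u v : ℝ → ℝ}, PairClass 3 I u v → HasDerivAt (fun y => bracket u v 2 y y)
      (bracket u v 3 x x + (deriv (deriv u) x * deriv v x - deriv u x * deriv (deriv v) x)) x := by
    intro u v huv
    have f0 := huv.contDiffOn_fst.hasDerivAt_iterate_deriv hIo 0 (by norm_num) x hx
    have g0 := huv.contDiffOn_snd.hasDerivAt_iterate_deriv hIo 0 (by norm_num) x hx
    have f2 := huv.contDiffOn_fst.hasDerivAt_iterate_deriv hIo 2 (by norm_num) x hx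
    have g2 := huv.contDiffOn_snd.hasDerivAt_iterate_deriv hIo 2 (by norm_num) x hx
    refine ((f2.mul g0).sub (g2.mul f0)).congr_deriv ?_
    simp [bracket]
    ring
  have hz : ∀ y ∈ I, wronski h k y * bracket f g 2 y y - wronski f g y * bracket h k 2 y y = 0 := by
    intro y hy
    have := bracketDiff_two_self hfg hhk hy
    rwa [hΦ y hy, sub_self, mul_zero] at this
  -- Differentiating the identity `hz`, which says that the `Phi` agree: the two terms containing
  -- derivatives of Wronskians cancel by `W' = bracket 2`.
  have h1 := ((hhk.hasDerivAt_wronski hIo hx).mul (hd hfg)).sub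
    ((hfg.hasDerivAt_wronski hIo hx).mul (hd hhk))
  have h2 := h1.unique ((hasDerivAt_const x (0 : ℝ)).congr_of_eventuallyEq
    (Filter.eventually_of_mem (hIo.mem_nhds hx) hz))
  have w1 := hfg.wronski_ne_zero (by norm_num) x hx
  have w2 := hhk.wronski_ne_zero (by norm_num) x hx
  rw [Psi_eq, Psi_eq, bracketDiff]
  field_simp
  linear_combination h2

/-! ### Directional derivatives of the family of means at a diagonal point -/

/-- The directional derivative of `m (·, t)` along `v` at the diagonal point `(x₀, …, x₀)`. -/
noncomputable def dirDeriv {d : ℕ} (m : (Fin d → ℝ) → T → ℝ) (x₀ : ℝ) (v : Fin d → ℝ) (t : T) :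
    ℝ :=
  fderiv ℝ (fun y => m y t) (diag d x₀) v

/-- The centred directional derivative. -/
noncomputable def centredDirDeriv {d : ℕ} (μ : Measure T) (m : (Fin d → ℝ) → T → ℝ) (x₀ : ℝ)
    (v : Fin d → ℝ) (t : T) : ℝ :=
  dirDeriv m x₀ v t - ∫ s, dirDeriv m x₀ v s ∂μ

/-- The difference quotient of `m (·, t)` along `v` at the diagonal point `(x₀, …, x₀)`. -/
noncomputable def diffQuot {d : ℕ} (m : (Fin d → ℝ) → T → ℝ) (x₀ : ℝ) (v : Fin d → ℝ) (s : ℝ)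
    (t : T) : ℝ :=
  s⁻¹ * (m (diag d x₀ + s • v) t - x₀)

theorem diag_mem_cube {I : Set ℝ} {x₀ : ℝ} (hx₀ : x₀ ∈ I) (d : ℕ) : diag d x₀ ∈ cube I d :=
  fun _ => hx₀

theorem eventually_diag_add_smul_mem {d : ℕ} {U : Set (Fin d → ℝ)} (hU : IsOpen U) {x₀ : ℝ}
    (hx₀ : diag d x₀ ∈ U) (v : Fin d → ℝ) : ∀ᶠ s in 𝓝[>] (0 : ℝ), diag d x₀ + s • v ∈ U := by
  have h : Tendsto (fun s : ℝ => diag d x₀ + s • v) (𝓝 0) (𝓝 (diag d x₀)) := by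
    have : Continuous fun s : ℝ => diag d x₀ + s • v := by fun_prop
    simpa using this.tendsto 0
  exact (h.mono_left nhdsWithin_le_nhds).eventually (hU.mem_nhds hx₀)

theorem abs_inv_mul_le {s a K : ℝ} (hs : 0 < s) (h : |a| ≤ s * K) : |s⁻¹ * a| ≤ K := by
  rw [abs_mul, abs_inv, abs_of_pos hs]
  exact (inv_mul_le_iff₀ hs).2 h

theorem norm_diag_add_smul_sub {d : ℕ} (x₀ : ℝ) (v : Fin d → ℝ) {s : ℝ} (hs : 0 < s) :
    ‖diag d x₀ + s • v - diag d x₀‖ = s * ‖v‖ := by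
  rw [add_sub_cancel_left, norm_smul, Real.norm_of_nonneg hs.le]

section

variable {I : Set ℝ} {d : ℕ} {m : (Fin d → ℝ) → T → ℝ} {x₀ : ℝ}

theorem MeasurableFamily.eventually_abs_diffQuot_le (hIo : IsOpen I) (hd : 0 < d)
    (hm : MeasurableFamily I m) (hx₀ : x₀ ∈ I) (v : Fin d → ℝ) :
    ∀ᶠ s in 𝓝[>] (0 : ℝ), ∀ t, |diffQuot m x₀ v s t| ≤ ‖v‖ := by
  filter_upwards [eventually_diag_add_smul_mem (isOpen_cube hIo d) (diag_mem_cube hx₀ d) v,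
    self_mem_nhdsWithin] with s hs hs0 t
  refine abs_inv_mul_le hs0 ((hm.dist_le hd hs x₀ t).trans_eq ?_)
  exact norm_diag_add_smul_sub x₀ v hs0

theorem MeasurableFamily.eventually_measurable_diffQuot (hIo : IsOpen I)
    (hm : MeasurableFamily I m) (hx₀ : x₀ ∈ I) (v : Fin d → ℝ) :
    ∀ᶠ s in 𝓝[>] (0 : ℝ), Measurable (diffQuot m x₀ v s) := by
  filter_upwards [eventually_diag_add_smul_mem (isOpen_cube hIo d) (diag_mem_cube hx₀ d) v]
    with s hs
  exact ((hm.measurable _ hs).sub_const _).const_mul _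

theorem MeasurableFamily.apply_diag (hd : 0 < d) (hm : MeasurableFamily I m) (hx₀ : x₀ ∈ I)
    (t : T) : m (diag d x₀) t = x₀ := by
  have := hm.dist_le hd (diag_mem_cube hx₀ d) x₀ t
  rw [sub_self, norm_zero] at this
  linarith [abs_nonpos_iff.1 this]

variable {μ : Measure T}

theorem FamilyClass1.hasFDerivAt (hIo : IsOpen I) (hm : FamilyClass1 I μ m) (hx₀ : x₀ ∈ I)
    (t : T) : HasFDerivAt (fun y => m y t) (fderiv ℝ (fun y => m y t) (diag d x₀)) (diag d x₀) :=
  (((hm.contDiffOn_one t).contDiffAt ((isOpen_cube hIo d).mem_nhds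
    (diag_mem_cube hx₀ d))).differentiableAt (by norm_num)).hasFDerivAt

theorem FamilyClass1.tendsto_diffQuot (hIo : IsOpen I) (hd : 0 < d) (hm : FamilyClass1 I μ m)
    (hx₀ : x₀ ∈ I) (v : Fin d → ℝ) (t : T) :
    Tendsto (fun s => diffQuot m x₀ v s t) (𝓝[>] 0) (𝓝 (dirDeriv m x₀ v t)) := by
  have h := ((hm.hasFDerivAt hIo hx₀ t).hasLineDerivAt v).tendsto_slope_zero_right
  simpa only [hm.apply_diag hd hx₀ t, smul_eq_mul, diffQuot, dirDeriv] using h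

/-- The bound of the difference quotients passes to the limit; it makes all powers of directional
derivatives integrable. -/
theorem FamilyClass1.abs_dirDeriv_le (hIo : IsOpen I) (hd : 0 < d) (hm : FamilyClass1 I μ m)
    (hx₀ : x₀ ∈ I) (v : Fin d → ℝ) (t : T) : |dirDeriv m x₀ v t| ≤ ‖v‖ :=
  le_of_tendsto (hm.tendsto_diffQuot hIo hd hx₀ v t).abs
    ((hm.eventually_abs_diffQuot_le hIo hd hx₀ v).mono fun _ h => h t)

theorem FamilyClass1.measurable_dirDeriv (hm : FamilyClass1 I μ m) (hx₀ : x₀ ∈ I)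
    (v : Fin d → ℝ) : Measurable (dirDeriv m x₀ v) := by
  have h : dirDeriv m x₀ v =
      fun t => ∑ i, v i * pderiv i (fun y => m y t) (diag d x₀) := by
    funext t
    rw [dirDeriv, ← ContinuousLinearMap.coe_coe, LinearMap.pi_apply_eq_sum_univ]
    refine Finset.sum_congr rfl fun i _ => ?_
    rw [smul_eq_mul, pderiv, ContinuousLinearMap.coe_coe]
    congr 2
    ext j
    simp [Pi.single_apply, eq_comm]
  rw [h]
  exact Finset.measurable_sum _ fun i _ =>
    ((hm.lqType_one_pderiv _ (diag_mem_cube hx₀ d) i).1).const_mul _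

theorem centredDirDeriv_neg (v : Fin d → ℝ) (t : T) :
    centredDirDeriv μ m x₀ (-v) t = -centredDirDeriv μ m x₀ v t := by
  simp only [centredDirDeriv, dirDeriv, map_neg, integral_neg]
  ring

theorem FamilyClass1.measurable_centredDirDeriv (hm : FamilyClass1 I μ m)
    (hx₀ : x₀ ∈ I) (v : Fin d → ℝ) : Measurable (centredDirDeriv μ m x₀ v) :=
  (hm.measurable_dirDeriv hx₀ v).sub_const _

variable [IsProbabilityMeasure μ]

theorem FamilyClass1.integrable_dirDeriv (hIo : IsOpen I) (hd : 0 < d) (hm : FamilyClass1 I μ m)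
    (hx₀ : x₀ ∈ I) (v : Fin d → ℝ) : Integrable (dirDeriv m x₀ v) μ :=
  Integrable.of_bound (hm.measurable_dirDeriv hx₀ v).aestronglyMeasurable ‖v‖
    (Eventually.of_forall (hm.abs_dirDeriv_le hIo hd hx₀ v))

theorem FamilyClass1.centredDirDeriv_add (hIo : IsOpen I) (hd : 0 < d) (hm : FamilyClass1 I μ m)
    (hx₀ : x₀ ∈ I) (v w : Fin d → ℝ) (t : T) : centredDirDeriv μ m x₀ (v + w) t =
      centredDirDeriv μ m x₀ v t + centredDirDeriv μ m x₀ w t := by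
  have h : ∀ t, dirDeriv m x₀ (v + w) t = dirDeriv m x₀ v t + dirDeriv m x₀ w t := fun t => by
    simp [dirDeriv]
  simp only [centredDirDeriv, h]
  rw [integral_add (hm.integrable_dirDeriv hIo hd hx₀ v) (hm.integrable_dirDeriv hIo hd hx₀ w)]
  ring

theorem FamilyClass1.abs_centredDirDeriv_le (hIo : IsOpen I) (hd : 0 < d)
    (hm : FamilyClass1 I μ m) (hx₀ : x₀ ∈ I) (v : Fin d → ℝ) (t : T) :
    |centredDirDeriv μ m x₀ v t| ≤ ‖v‖ + ‖v‖ := by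
  refine (abs_sub _ _).trans (add_le_add (hm.abs_dirDeriv_le hIo hd hx₀ v t) ?_)
  have := norm_integral_le_of_norm_le_const (μ := μ) (f := dirDeriv m x₀ v) (C := ‖v‖)
    (Eventually.of_forall fun t => hm.abs_dirDeriv_le hIo hd hx₀ v t)
  simpa using this

theorem FamilyClass1.integrable_centredDirDeriv_pow (hIo : IsOpen I) (hd : 0 < d)
    (hm : FamilyClass1 I μ m) (hx₀ : x₀ ∈ I) (v : Fin d → ℝ) (n : ℕ) :
    Integrable (fun t => centredDirDeriv μ m x₀ v t ^ n) μ := by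
  refine Integrable.of_bound ((hm.measurable_centredDirDeriv hx₀ v).pow_const n).aestronglyMeasurable
    ((‖v‖ + ‖v‖) ^ n) (Eventually.of_forall fun t => ?_)
  rw [norm_pow]
  exact pow_le_pow_left₀ (norm_nonneg _) (hm.abs_centredDirDeriv_le hIo hd hx₀ v t) n

/-- Polarization of the cubic form `v ↦ ∫ (∂ᵥ* m)³ dμ`. -/
theorem FamilyClass1.exists_integral_cube_ne_zero (hIo : IsOpen I) (hd : 0 < d)
    (hm : FamilyClass1 I μ m) (hx₀ : x₀ ∈ I) {i j l : Fin d}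
    (h : ∫ t, cpderiv μ m i (diag d x₀) t * cpderiv μ m j (diag d x₀) t *
      cpderiv μ m l (diag d x₀) t ∂μ ≠ 0) :
    ∃ v : Fin d → ℝ, ∫ t, centredDirDeriv μ m x₀ v t ^ 3 ∂μ ≠ 0 := by
  by_contra! hcon
  apply h
  set u : Fin d → ℝ := Pi.single i 1
  set v : Fin d → ℝ := Pi.single j 1
  set w : Fin d → ℝ := Pi.single l 1
  have hi := fun v => hm.integrable_centredDirDeriv_pow hIo hd hx₀ v 3
  -- The identity `24abc = (a+b+c)³ + (a-b-c)³ + (-a+b-c)³ + (-a-b+c)³`.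
  have hid : ∀ t, cpderiv μ m i (diag d x₀) t * cpderiv μ m j (diag d x₀) t *
      cpderiv μ m l (diag d x₀) t = (1 / 24) * (centredDirDeriv μ m x₀ (u + v + w) t ^ 3 +
        centredDirDeriv μ m x₀ (u + -v + -w) t ^ 3 + centredDirDeriv μ m x₀ (-u + v + -w) t ^ 3 +
        centredDirDeriv μ m x₀ (-u + -v + w) t ^ 3) := by
    intro t
    simp only [hm.centredDirDeriv_add hIo hd hx₀, centredDirDeriv_neg]
    change centredDirDeriv μ m x₀ u t * centredDirDeriv μ m x₀ v t *
      centredDirDeriv μ m x₀ w t = _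
    ring
  simp only [hid]
  have hi2 : ∀ a b, Integrable (fun t => centredDirDeriv μ m x₀ a t ^ 3 +
      centredDirDeriv μ m x₀ b t ^ 3) μ := fun a b => (hi a).add (hi b)
  have hi3 : ∀ a b c, Integrable (fun t => centredDirDeriv μ m x₀ a t ^ 3 +
      centredDirDeriv μ m x₀ b t ^ 3 + centredDirDeriv μ m x₀ c t ^ 3) μ :=
    fun a b c => (hi2 a b).add (hi c)
  rw [integral_const_mul, integral_add (hi3 _ _ _) (hi _), integral_add (hi2 _ _) (hi _),
    integral_add (hi _) (hi _)]
  simp [hcon]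

/-- A nonzero third moment entails a nonzero second moment. -/
theorem FamilyClass1.integral_sq_ne_zero (hIo : IsOpen I) (hd : 0 < d)
    (hm : FamilyClass1 I μ m) (hx₀ : x₀ ∈ I) {v : Fin d → ℝ}
    (h : ∫ t, centredDirDeriv μ m x₀ v t ^ 3 ∂μ ≠ 0) :
    ∫ t, centredDirDeriv μ m x₀ v t ^ 2 ∂μ ≠ 0 := by
  contrapose! h
  have h1 := (integral_eq_zero_iff_of_nonneg (fun t => sq_nonneg _)
    (hm.integrable_centredDirDeriv_pow hIo hd hx₀ v 2)).1 h
  refine integral_eq_zero_of_ae ?_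
  filter_upwards [h1] with t ht
  have h2 : centredDirDeriv μ m x₀ v t = 0 := by simpa using ht
  simp [h2]

/-- Moments of difference quotients converge to moments of the centred directional derivative. -/
theorem FamilyClass1.tendsto_moment_diffQuot (hIo : IsOpen I) (hd : 0 < d)
    (hm : FamilyClass1 I μ m) (hx₀ : x₀ ∈ I) (v : Fin d → ℝ) {η : ℝ → ℝ} {e : ℝ}
    (hη : ∀ᶠ s in 𝓝[>] (0 : ℝ), |η s| ≤ ‖v‖) (hlim : Tendsto η (𝓝[>] 0) (𝓝 e)) (n : ℕ) :
    Tendsto (fun s => ∫ t, (diffQuot m x₀ v s t - η s) ^ n ∂μ) (𝓝[>] 0)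
      (𝓝 (∫ t, (dirDeriv m x₀ v t - e) ^ n ∂μ)) := by
  refine tendsto_integral_filter_of_dominated_convergence (fun _ => (‖v‖ + ‖v‖) ^ n) ?_ ?_
    (integrable_const _) ?_
  · filter_upwards [hm.eventually_measurable_diffQuot hIo hx₀ v] with s hs
    exact ((hs.sub_const _).pow_const n).aestronglyMeasurable
  · filter_upwards [hη, hm.eventually_abs_diffQuot_le hIo hd hx₀ v] with s hs1 hs2
    refine Eventually.of_forall fun t => ?_
    rw [norm_pow]
    exact pow_le_pow_left₀ (norm_nonneg _)
      ((abs_sub _ _).trans (add_le_add (hs2 t) hs1)) n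
  · exact Eventually.of_forall fun t =>
      ((hm.tendsto_diffQuot hIo hd hx₀ v t).sub hlim).pow n

/-! ### First order behaviour of the generalized mean -/

variable {f g h k : ℝ → ℝ}

theorem eventually_abs_bajMean_quot_le (hIo : IsOpen I) (hIc : I.OrdConnected) (hd : 0 < d)
    (hfg : PairClass 3 I f g) (hm : MeasurableFamily I m) (hx₀ : x₀ ∈ I) (v : Fin d → ℝ) :
    ∀ᶠ s in 𝓝[>] (0 : ℝ), |s⁻¹ * (bajMean I f g m μ (diag d x₀ + s • v) - x₀)| ≤ ‖v‖ := by
  filter_upwards [eventually_diag_add_smul_mem (isOpen_cube hIo d) (diag_mem_cube hx₀ d) v,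
    self_mem_nhdsWithin] with s hs hs0
  refine abs_inv_mul_le hs0 ((bajMean_dist_le hIo hIc hd (hfg.mono_zero subset_rfl) hm μ hs
    x₀).trans_eq ?_)
  exact norm_diag_add_smul_sub x₀ v hs0

theorem MeasurableFamily.integrable_chebDet (hIo : IsOpen I) (hIc : I.OrdConnected) (hd : 0 < d)
    (hfg : PairClass 3 I f g) (hm : MeasurableFamily I m) {x : Fin d → ℝ} (hx : x ∈ cube I d)
    (y : ℝ) : Integrable (fun t => chebDet f g (m x t) y) μ := by
  have h1 := hfg.contDiffOn_fst.continuousOn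
  have h2 := hfg.contDiffOn_snd.continuousOn
  refine hm.integrable_comp hIo hIc hd μ hx (φ := fun z => chebDet f g z y) ?_
  simp only [chebDet_apply]
  fun_prop

theorem add_mul_inv_mul {s : ℝ} (hs : 0 < s) (x y : ℝ) : x + s * (s⁻¹ * (y - x)) = y := by
  field_simp
  ring

/-- The moment lemma of order one, applied to the determinant of the pair, gives `∫ (Q - η) → 0`
because the Wronskian is nonzero; and `∫ Q` tends to the integral of the directional derivative by
dominated convergence. -/
theorem FamilyClass1.tendsto_bajMean_quot (hIo : IsOpen I) (hIc : I.OrdConnected) (hd : 0 < d)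
    (hfg : PairClass 3 I f g) (hm : FamilyClass1 I μ m) (hx₀ : x₀ ∈ I) (v : Fin d → ℝ) :
    Tendsto (fun s => s⁻¹ * (bajMean I f g m μ (diag d x₀ + s • v) - x₀)) (𝓝[>] 0)
      (𝓝 (∫ t, dirDeriv m x₀ v t ∂μ)) := by
  set η : ℝ → ℝ := fun s => s⁻¹ * (bajMean I f g m μ (diag d x₀ + s • v) - x₀) with hη
  have hmem := eventually_diag_add_smul_mem (isOpen_cube hIo d) (diag_mem_cube hx₀ d) v
  have h1 := tendsto_moment_of_integral_eq_zero μ hIo hx₀ 1 (bracket f g)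
    (fun j hj y _ z hz => hfg.hasDerivAt_bracket hIo (by omega) y hz)
    (fun j hj y _ => by
      obtain rfl : j = 0 := by omega
      rw [bracket_zero, chebDet_apply]; ring)
    (hfg.continuousAt_bracket hIo (by norm_num) hx₀ hx₀) (diffQuot m x₀ v) η
    (hm.eventually_measurable_diffQuot hIo hx₀ v)
    (hm.eventually_abs_diffQuot_le hIo hd hx₀ v)
    (eventually_abs_bajMean_quot_le hIo hIc hd hfg hm.toMeasurableFamily hx₀ v)
    (by
      filter_upwards [hmem, self_mem_nhdsWithin] with s hs hs0
      simp only [hη, diffQuot, add_mul_inv_mul hs0, bracket_zero]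
      exact hm.integrable_chebDet hIo hIc hd hfg hs _)
    (by
      filter_upwards [hmem, self_mem_nhdsWithin] with s hs hs0
      simp only [hη, diffQuot, add_mul_inv_mul hs0, bracket_zero]
      exact (bajMean_spec hIo hIc hd (hfg.mono_zero subset_rfl) hm.toMeasurableFamily μ hs).2)
  rw [bracket_one_self] at h1
  have hW := hfg.wronski_ne_zero (by norm_num) x₀ hx₀
  have h2 := h1.const_mul (wronski f g x₀)⁻¹
  simp only [inv_mul_cancel_left₀ hW, mul_zero, pow_one] at h2
  -- The choice `η = 0`, `n = 1` yields the limit of `∫ Q`.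
  have h3 := hm.tendsto_moment_diffQuot hIo hd hx₀ v (η := fun _ => 0) (e := 0)
    (Eventually.of_forall fun _ => by simp) tendsto_const_nhds 1
  simp only [sub_zero, pow_one] at h3
  have h4 := h3.sub h2
  rw [sub_zero] at h4
  refine h4.congr' ?_
  filter_upwards [hm.eventually_measurable_diffQuot hIo hx₀ v,
    hm.eventually_abs_diffQuot_le hIo hd hx₀ v] with s hs1 hs2
  have : Integrable (diffQuot m x₀ v s) μ :=
    Integrable.of_bound hs1.aestronglyMeasurable ‖v‖ (Eventually.of_forall hs2)
  rw [integral_sub this (integrable_const _)]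
  simp

/-- If the means generated by two pairs agree near `(x₀, …, x₀)`, then, at the first order at which
the difference of the two determinants does not vanish identically, its coefficient is annihilated
by the moments of the centred directional derivatives. -/
theorem FamilyClass1.bracketDiff_mul_moment_eq_zero (hIo : IsOpen I) (hIc : I.OrdConnected)
    (hd : 0 < d) (hfg : PairClass 3 I f g) (hhk : PairClass 3 I h k) (hm : FamilyClass1 I μ m)
    (hx₀ : x₀ ∈ I) (v : Fin d → ℝ)
    (heq : ∀ᶠ s in 𝓝[>] (0 : ℝ), bajMean I f g m μ (diag d x₀ + s • v) =
      bajMean I h k m μ (diag d x₀ + s • v)) {n : ℕ} (hn : n ≤ 3)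
    (hvan : ∀ j < n, ∀ y ∈ I, bracketDiff f g h k j y y = 0) :
    bracketDiff f g h k n x₀ x₀ * ∫ t, centredDirDeriv μ m x₀ v t ^ n ∂μ = 0 := by
  set η : ℝ → ℝ := fun s => s⁻¹ * (bajMean I f g m μ (diag d x₀ + s • v) - x₀) with hη
  have hmem := eventually_diag_add_smul_mem (isOpen_cube hIo d) (diag_mem_cube hx₀ d) v
  have hηb := eventually_abs_bajMean_quot_le hIo hIc hd hfg hm.toMeasurableFamily hx₀ v (μ := μ)
  have hi : ∀ {u w : ℝ → ℝ}, PairClass 3 I u w → ∀ x ∈ cube I d, ∀ y, Integrable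
      (fun t => bracket u w 0 y (m x t)) μ := fun hp x hx y => by
    simp only [bracket_zero]
    exact hm.integrable_chebDet hIo hIc hd hp hx y
  have h1 := tendsto_moment_of_integral_eq_zero μ hIo hx₀ n (bracketDiff f g h k)
    (fun j hj y _ z hz => ((hfg.hasDerivAt_bracket hIo (by omega) y hz).const_mul _).sub
      ((hhk.hasDerivAt_bracket hIo (by omega) y hz).const_mul _))
    hvan
    ((((hhk.continuousAt_wronski (by norm_num) hIo hx₀).comp' (f := Prod.fst)
      (x := (x₀, x₀)) continuousAt_fst).mul (hfg.continuousAt_bracket hIo hn hx₀ hx₀)).sub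
      (((hfg.continuousAt_wronski (by norm_num) hIo hx₀).comp' (f := Prod.fst)
      (x := (x₀, x₀)) continuousAt_fst).mul (hhk.continuousAt_bracket hIo hn hx₀ hx₀)))
    (diffQuot m x₀ v) η
    (hm.eventually_measurable_diffQuot hIo hx₀ v)
    (hm.eventually_abs_diffQuot_le hIo hd hx₀ v) hηb
    (by
      filter_upwards [hmem, self_mem_nhdsWithin] with s hs hs0
      simp only [hη, diffQuot, add_mul_inv_mul hs0, bracketDiff]
      exact ((hi hfg _ hs _).const_mul _).sub ((hi hhk _ hs _).const_mul _))
    -- By `heq` the same point solves the defining equations of both pairs, so each of the two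
    -- integrals vanishes.
    (by
      filter_upwards [hmem, self_mem_nhdsWithin, heq] with s hs hs0 he
      simp only [hη, diffQuot, add_mul_inv_mul hs0, bracketDiff]
      rw [integral_sub ((hi hfg _ hs _).const_mul _) ((hi hhk _ hs _).const_mul _),
        integral_const_mul, integral_const_mul]
      simp only [bracket_zero]
      rw [(bajMean_spec hIo hIc hd (hfg.mono_zero subset_rfl) hm.toMeasurableFamily μ hs).2, he,
        (bajMean_spec hIo hIc hd (hhk.mono_zero subset_rfl) hm.toMeasurableFamily μ hs).2]
      simp)
  have h2 := (hm.tendsto_moment_diffQuot hIo hd hx₀ v hηb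
    (hm.tendsto_bajMean_quot hIo hIc hd hfg hx₀ v) n).const_mul (bracketDiff f g h k n x₀ x₀)
  -- The limit of `η` is the mean of the directional derivative, so the limiting moment is the
  -- centred one.
  exact tendsto_nhds_unique h2 h1

end

/-! ### Equality of the invariants -/

theorem PairClass.continuousOn_Phi {I : Set ℝ} (hIo : IsOpen I) {f g : ℝ → ℝ}
    (hfg : PairClass 3 I f g) : ContinuousOn (Phi f g) I := by
  intro x hx
  have h1 : ContinuousAt (fun y => bracket f g 2 y y) x :=
    (hfg.continuousAt_bracket hIo (by norm_num) hx hx).comp (f := fun y => (y, y))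
      (continuousAt_id.prodMk continuousAt_id)
  have h2 := h1.div (hfg.continuousAt_wronski (by norm_num) hIo hx)
    (hfg.wronski_ne_zero (by norm_num) x hx)
  exact (h2.congr (Eventually.of_forall fun y => (Phi_eq f g y).symm)).continuousWithinAt

theorem PairClass.continuousOn_Psi {I : Set ℝ} (hIo : IsOpen I) {f g : ℝ → ℝ}
    (hfg : PairClass 3 I f g) : ContinuousOn (Psi f g) I := by
  have f1 := hfg.contDiffOn_fst.continuousOn_iterate_deriv hIo 1 (by norm_num)
  have g1 := hfg.contDiffOn_snd.continuousOn_iterate_deriv hIo 1 (by norm_num)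
  have f2 := hfg.contDiffOn_fst.continuousOn_iterate_deriv hIo 2 (by norm_num)
  have g2 := hfg.contDiffOn_snd.continuousOn_iterate_deriv hIo 2 (by norm_num)
  have hW : ContinuousOn (wronski f g) I := fun x hx =>
    (hfg.continuousAt_wronski (by norm_num) hIo hx).continuousWithinAt
  exact ((((f2.mul g1).sub (f1.mul g2)).neg).div hW
    (hfg.wronski_ne_zero (by norm_num))).congr fun x _ => Psi_eq f g x

/-! ### From equal invariants to equivalent pairs. -/

/-- The generating functions solve `u'' = Φ u' + Ψ u`. -/
theorem PairClass.deriv_deriv_eq {I : Set ℝ} {f g : ℝ → ℝ} (hfg : PairClass 3 I f g) {x : ℝ}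
    (hx : x ∈ I) : deriv (deriv f) x = Phi f g x * deriv f x + Psi f g x * f x ∧
      deriv (deriv g) x = Phi f g x * deriv g x + Psi f g x * g x := by
  have hW := hfg.wronski_ne_zero (by norm_num) x hx
  have h := wronski_apply f g x
  rw [Phi_eq, Psi_eq]
  constructor <;> field_simp <;> rw [h] <;> simp [bracket] <;> ring

/-- A solution of `u'' = Φ u' + Ψ u` is a linear combination of two independent ones. -/
theorem PairClass.exists_linear_combination {I : Set ℝ} (hIo : IsOpen I) (hIc : I.OrdConnected)
    (hne : I.Nonempty) {h k u : ℝ → ℝ} (hhk : PairClass 3 I h k) (hu : ContDiffOn ℝ 3 u I)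
    (hode : ∀ x ∈ I, deriv (deriv u) x = Phi h k x * deriv u x + Psi h k x * u x) :
    ∃ α β : ℝ, ∀ x ∈ I, u x = α * h x + β * k x := by
  have hu' : ContDiffOn ℝ (3 : ℕ) u I := hu
  -- Abel's argument: the Wronskians of any two solutions satisfy the same equation `W' = Φ W`, so
  -- their quotient by `wronski h k` is constant.
  have key : ∀ {w : ℝ → ℝ}, ContDiffOn ℝ (3 : ℕ) w I →
      (∀ x ∈ I, deriv (deriv w) x = Phi h k x * deriv w x + Psi h k x * w x) →
      ∃ c : ℝ, ∀ x ∈ I, wronski u w x = c * wronski h k x := by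
    intro w hw hwode
    obtain ⟨x₁, hx₁⟩ := hne
    have hder : ∀ x ∈ I, HasDerivAt (fun y => wronski u w y / wronski h k y) 0 x := by
      intro x hx
      have hW := hhk.wronski_ne_zero (by norm_num) x hx
      have u0 := hu'.hasDerivAt_iterate_deriv hIo 0 (by norm_num) x hx
      have w0 := hw.hasDerivAt_iterate_deriv hIo 0 (by norm_num) x hx
      have u1 := hu'.hasDerivAt_iterate_deriv hIo 1 (by norm_num) x hx
      have w1 := hw.hasDerivAt_iterate_deriv hIo 1 (by norm_num) x hx
      have h1 : HasDerivAt (wronski u w) (Phi h k x * wronski u w x) x := by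
        rw [funext (wronski_apply u w)]
        refine ((u1.mul w0).sub (u0.mul w1)).congr_deriv ?_
        simp [hode x hx, hwode x hx]
        ring
      have h2 : HasDerivAt (wronski h k) (Phi h k x * wronski h k x) x := by
        refine (hhk.hasDerivAt_wronski hIo hx).congr_deriv ?_
        rw [Phi_eq, div_mul_cancel₀ _ hW]
      refine (h1.div h2 hW).congr_deriv ?_
      field_simp
      ring
    refine ⟨wronski u w x₁ / wronski h k x₁, fun x hx => ?_⟩
    have : wronski u w x₁ / wronski h k x₁ = wronski u w x / wronski h k x :=
      hIo.is_const_of_deriv_eq_zero hIc.isPreconnected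
      (fun y hy => (hder y hy).differentiableAt.differentiableWithinAt)
      (fun y hy => (hder y hy).deriv) hx₁ hx
    rw [this, div_mul_cancel₀ _ (hhk.wronski_ne_zero (by norm_num) x hx)]
  obtain ⟨a, ha⟩ := key hhk.contDiffOn_snd fun x hx => (hhk.deriv_deriv_eq hx).2
  obtain ⟨b, hb⟩ := key hhk.contDiffOn_fst fun x hx => (hhk.deriv_deriv_eq hx).1
  refine ⟨a, -b, fun x hx => ?_⟩
  have hW := hhk.wronski_ne_zero (by norm_num) x hx
  have ha := ha x hx
  have hb := hb x hx
  -- The coefficients come from the identity `u W(h,k) = h W(u,k) - k W(u,h)`.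
  refine mul_right_cancel₀ hW ?_
  have e1 := wronski_apply h k x
  rw [wronski_apply u] at ha hb
  linear_combination u x * e1 + h x * ha - k x * hb

theorem PairClass.equivPairs {I : Set ℝ} (hIo : IsOpen I) (hIc : I.OrdConnected)
    (hne : I.Nonempty) {f g h k : ℝ → ℝ} (hfg : PairClass 3 I f g) (hhk : PairClass 3 I h k)
    (hΦ : ∀ x ∈ I, Phi f g x = Phi h k x) (hΨ : ∀ x ∈ I, Psi f g x = Psi h k x) :
    EquivPairs I f g h k := by
  obtain ⟨α, β, h1⟩ := hhk.exists_linear_combination hIo hIc hne hfg.contDiffOn_fst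
    fun x hx => by rw [← hΦ x hx, ← hΨ x hx]; exact (hfg.deriv_deriv_eq hx).1
  obtain ⟨γ, δ, h2⟩ := hhk.exists_linear_combination hIo hIc hne hfg.contDiffOn_snd
    fun x hx => by rw [← hΦ x hx, ← hΨ x hx]; exact (hfg.deriv_deriv_eq hx).2
  refine ⟨α, β, γ, δ, fun hdet => ?_, fun x hx => ⟨h1 x hx, h2 x hx⟩⟩
  -- If the coefficient determinant vanished, so would `chebDet f g` at any two points; a second
  -- point of `I` gives a contradiction.
  obtain ⟨x, hx⟩ := hne
  obtain ⟨r, hr, hball⟩ := Metric.isOpen_iff.1 hIo x hx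
  have hy : x + r / 2 ∈ I := hball (by
    rw [Metric.mem_ball, Real.dist_eq, add_sub_cancel_left, abs_of_pos (by linarith)]; linarith)
  refine hfg.chebyshev x hx _ hy (by linarith) ?_
  rw [chebDet_apply, h1 x hx, h2 x hx, h1 _ hy, h2 _ hy]
  linear_combination (h x * k (x + r / 2) - h (x + r / 2) * k x) * hdet

/-! ### From equal means to equal invariants. -/

/-- Means that agree near a dense set of diagonal points have the same invariants. -/
theorem FamilyClass1.Phi_Psi_eq {I : Set ℝ} (hIo : IsOpen I) (hIc : I.OrdConnected) {d : ℕ}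
    {m : (Fin d → ℝ) → T → ℝ} {μ : Measure T} [IsProbabilityMeasure μ] {f g h k : ℝ → ℝ}
    (hfg : PairClass 3 I f g) (hhk : PairClass 3 I h k) (hm : FamilyClass1 I μ m) {D : Set ℝ}
    (hDI : D ⊆ I) (hDdense : I ⊆ closure D)
    (hD : ∀ x ∈ D, ∃ i j l, ∫ t, cpderiv μ m i (diag d x) t * cpderiv μ m j (diag d x) t *
        cpderiv μ m l (diag d x) t ∂μ ≠ 0)
    {U : Set (Fin d → ℝ)} (hU : IsOpen U) (hDU : ∀ x ∈ D, diag d x ∈ U)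
    (heq : ∀ x ∈ U, bajMean I f g m μ x = bajMean I h k m μ x) :
    (∀ x ∈ I, Phi f g x = Phi h k x) ∧ (∀ x ∈ I, Psi f g x = Psi h k x) := by
  have hloc : ∀ x ∈ D, ∀ n ≤ 3, 2 ≤ n →
      (∀ j < n, ∀ y ∈ I, bracketDiff f g h k j y y = 0) → bracketDiff f g h k n x x = 0 := by
    intro x hx
    obtain ⟨i, j, l, hijl⟩ := hD x hx
    -- The mere existence of an index excludes dimension zero.
    have hd : 0 < d := i.pos
    obtain ⟨v, hv⟩ := hm.exists_integral_cube_ne_zero hIo hd (hDI hx) hijl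
    have hv2 := hm.integral_sq_ne_zero hIo hd (hDI hx) hv
    intro n hn hn2 hvan
    have h1 := hm.bracketDiff_mul_moment_eq_zero hIo hIc hd hfg hhk (hDI hx) v
      ((eventually_diag_add_smul_mem hU (hDU x hx) v).mono fun s hs => heq _ hs) hn hvan
    refine (mul_eq_zero.1 h1).resolve_right ?_
    obtain rfl | rfl : n = 2 ∨ n = 3 := by omega
    · exact hv2
    · exact hv
  have hW : ∀ x ∈ I, wronski f g x * wronski h k x ≠ 0 := fun x hx =>
    mul_ne_zero (hfg.wronski_ne_zero (by norm_num) x hx) (hhk.wronski_ne_zero (by norm_num) x hx)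
  have hΦD : Set.EqOn (Phi f g) (Phi h k) D := by
    intro x hx
    have h1 := hloc x hx 2 (by norm_num) le_rfl fun j hj y _ => by
      interval_cases j
      · exact bracketDiff_zero_self f g h k y
      · exact bracketDiff_one_self f g h k y
    rw [bracketDiff_two_self hfg hhk (hDI hx)] at h1
    exact sub_eq_zero.1 ((mul_eq_zero.1 h1).resolve_left (hW x (hDI hx)))
  -- Equality on all of `I` is needed before going to third order: the expansion is based at the
  -- mean, which may leave `D`, so the second order term must vanish at every point of `I`.
  have hΦ : Set.EqOn (Phi f g) (Phi h k) I :=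
    hΦD.of_subset_closure (hfg.continuousOn_Phi hIo) (hhk.continuousOn_Phi hIo) hDI hDdense
  have hΨD : Set.EqOn (Psi f g) (Psi h k) D := by
    intro x hx
    have h1 := hloc x hx 3 le_rfl (by norm_num) fun j hj y hy => by
      interval_cases j
      · exact bracketDiff_zero_self f g h k y
      · exact bracketDiff_one_self f g h k y
      · rw [bracketDiff_two_self hfg hhk hy, hΦ hy, sub_self, mul_zero]
    rw [bracketDiff_three_self hIo hfg hhk hΦ (hDI hx)] at h1
    exact sub_eq_zero.1 ((mul_eq_zero.1 h1).resolve_left (hW x (hDI hx)))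
  exact ⟨hΦ, hΨD.of_subset_closure (hfg.continuousOn_Psi hIo) (hhk.continuousOn_Psi hIo) hDI
    hDdense⟩

end GenMean

theorem mainTheorem1 {T : Type*} [MeasurableSpace T] (μ : MeasureTheory.Measure T)
    [MeasureTheory.IsProbabilityMeasure μ] (I : Set ℝ) (hIo : IsOpen I) (hIc : I.OrdConnected)
    (hIne : I.Nonempty) (d : ℕ) (f g h k : ℝ → ℝ)
    (hfg : GenMean.PairClass 3 I f g) (hhk : GenMean.PairClass 3 I h k)
    (m : (Fin d → ℝ) → T → ℝ) (hm : GenMean.FamilyClass3 I μ m)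
    (D : Set ℝ) (hDI : D ⊆ I) (hDdense : I ⊆ closure D)
    (hD₁ : ∀ x ∈ D, μ {t | ∀ i, GenMean.cpderiv μ m i (GenMean.diag d x) t = 0} < 1)
    (hD₂ : ∀ x ∈ D, ∃ i j l,
      ∫ t, GenMean.cpderiv μ m i (GenMean.diag d x) t * GenMean.cpderiv μ m j (GenMean.diag d x) t *
        GenMean.cpderiv μ m l (GenMean.diag d x) t ∂μ ≠ 0) :
    List.TFAE [
      ∀ x ∈ GenMean.cube I d, GenMean.bajMean I f g m μ x = GenMean.bajMean I h k m μ x,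
      ∃ U ⊆ GenMean.cube I d, IsOpen U ∧ (∀ x ∈ D, GenMean.diag d x ∈ U) ∧
        ∀ x ∈ U, GenMean.bajMean I f g m μ x = GenMean.bajMean I h k m μ x,
      (∀ x ∈ I, GenMean.Phi f g x = GenMean.Phi h k x) ∧
        (∀ x ∈ I, GenMean.Psi f g x = GenMean.Psi h k x),
      GenMean.EquivPairs I f g h k] := by
  tfae_have 1 → 2 := fun H => ⟨GenMean.cube I d, subset_rfl, GenMean.isOpen_cube hIo d,
    fun x hx => GenMean.diag_mem_cube (hDI hx) d, H⟩
  tfae_have 2 → 3 := fun ⟨U, _, hU, hDU, H⟩ =>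
    hm.toFamilyClass1.Phi_Psi_eq hIo hIc hfg hhk hDI hDdense hD₂ hU hDU H
  tfae_have 3 → 4 := fun H => hfg.equivPairs hIo hIc hIne hhk H.1 H.2
  tfae_have 4 → 1 := fun H x hx => H.bajMean_eq hm.toMeasurableFamily μ hx
  tfae_finish
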